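/- **Setting.** There are $N\ge 1$ controllable agents $\mathcal N=\{1,\dots,N\}$ and $V\ge 0$ uncontrollable agents $\mathcal V=\{N+1,\dots,N+V\}$; put $\mathcal N^+=\mathcal N\cup\mathcal V$. Agent $i\in\mathcal N^+$ has state $x_i\in\mathbb R^n$, input $u_i\in\mathbb R^m$ and dynamics $\dot x_i=f(x_i)+g(x_i)u_i$, with $f:\mathbb R^n\to\mathbb R^n$ globally Lipschitz and $g:\mathbb R^n\to\mathbb R^{n\times m}$ locally Lipschitz. Write $x=(x_1,\dots,x_{N+V})$. Let $h:\mathbb R^{(N+V)n}\to\mathbb R$ be continuously differentiable (it may depend on the states of all agents, controllable or not), and let $\mathcal C=\{x: h(x)\ge 0\}$ be the safe set. The controllable agents communicate over an undirected graph on $\mathcal N$ without self-loops. For $i\in\mathcal N$: $a_{ij}=1$ if $j\in\mathcal N$ is a neighbour of $i$ or $j\in\mathcal V$ is an agent whose state is obtained by $i$, and $a_{ij}=0$ otherwise; $b_{ij}=a_{ij}$ for $j\ne i$ and $b_{ii}=1$. **Distributed scheme.** Every agent $i\in\mathcal N$ runs the following. (a) Adaptive observers, for all $l\in\mathcal N^+$: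 $$\dot{\hat x}_{i,l}=f(\hat x_{i,l})-\hat\delta_{i,l}\xi_{i,l},\quad \xi_{i,l}=\sum_{j=1}^N a_{ij}(\hat x_{i,l}-\hat x_{j,l})+b_{il}(\hat x_{i,l}-x_l),\quad \dot{\hat\delta}_{i,l}=2\xi_{i,l}^TP_l\xi_{i,l}-\sigma_l\hat\delta_{i,l},$$ with $P_l$ symmetric positive definite and $\sigma_l>0$. (b) The reconstructed barrier function $\hat h_i=h(\hat\upsilon_i)-\vartheta_i$, where $\hat\upsilon_i$ is $x$ with each block $x_j$, $j\ne i$, replaced by $\hat x_{i,j}$. Let $e_i=h(x)-\hat h_i$, $\rho_i(t)=(\rho_0^i-\rho_\infty^i)e^{-\varrho t}+\rho_\infty^i$, $\varepsilon_i=\frac12\ln\frac{e_i}{\rho_i-e_i}$, $\hat{\bar x}_i=(\hat x_{i,1},\dots,\hat x_{i,N+V})$, $M_i=\big\|\frac{dh(\hat\upsilon_i)}{d\hat\upsilon_i}\big\|+\|\dot{\hat{\bar x}}_i\|$ and $\chi_i=\frac{\varepsilon_i\rho_i}{2e_i(\rho_i-e_i)}M_i$. The adaptive parameters $\vartheta_i,\hat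 r_i$ satisfy $$\dot\vartheta_i=-c_i\frac{e_i(\rho_i-e_i)}{\rho_i}\varepsilon_i-\frac{\varrho e_i}{\rho_i}(\rho_0^i-\rho_\infty^i)e^{-\varrho t}-\frac{\rho_i\varepsilon_i}{4e_i(\rho_i-e_i)}-\frac{\hat r_i^2M_i\chi_i}{\sqrt{\chi_i^2\hat r_i^2+\epsilon_i^2}},$$ $$\dot{\hat r}_i=\frac{\gamma_i|\varepsilon_i|\rho_i}{2e_i(\rho_i-e_i)}M_i-\varsigma_i\hat r_i,$$ with $c_i,\varrho,\epsilon_i,\varsigma_i,\gamma_i>0$ and $0<\rho_\infty^i<\rho_0^i$. The initial values satisfy $0<e_i(0)<\rho_0^i$ and $\hat h_i(0)\ge 0$. (c) The input $u_i$ is a minimizer over $\nu\in\mathbb R^m$ of $\frac12(\nu-u_{i,\mathrm{nom}})^TW_i(\nu-u_{i,\mathrm{nom}})$ subject to $$\frac{\partial\hat h_i}{\partial x_i}\big(f(x_i)+g(x_i)\nu\big)+\sum_{l\in\mathcal N^+,\,l\ne i}\frac{\partial\hat h_i}{\partial\hat x_{i,l}}\dot{\hat x}_{i,l}-\dot\vartheta_i\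 \ge\ -\alpha_i(\hat h_i),$$ where $u_{i,\mathrm{nom}}$ is an arbitrary nominal input, $W_i$ is positive definite, and $\alpha_i:\mathbb R\to\mathbb R$ is continuous and strictly increasing with $\alpha_i(0)=0$. The laws in (b) and (c) are imposed at the times at which their right-hand sides are defined, that is, when $0<e_i<\rho_i$. The inputs $u_l$, $l\in\mathcal V$, are arbitrary. **Theorem.** Assume that 1. the graph on $\mathcal N$ is connected, and the state of each $l\in\mathcal V$ is obtained by at least one $i\in\mathcal N$; 2. there is $D>0$ with $\|g(x_i(t))u_i(t)\|\le D$ for all $i\in\mathcal N^+$ and all $t$; 3. the derivative of $h$ is locally Lipschitz; 4. each controllable agent knows the function $h$ and its current value $h(x(t))$ (as the scheme above uses them); 5. $h(x(0))>0$. Then along every solution of the closed loop on an interval $[0,T)$, $0<T\le\infty$, one has $x(t)\in\mathcal C$, i.e. $h(x(t))\ge 0$, for all $t\in[0,T)$. Thus the scheme renders $\mathcal C$ forward invariant, also when $h$ depends on the states of uncontrollable agents. -/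

import Mathlib

open scoped BigOperators

noncomputable section

namespace SafeMAS

/-- The space `ℝⁿ` with its Euclidean norm. -/
abbrev Vec (n : ℕ) : Type := EuclideanSpace ℝ (Fin n)

/-- All agents: `N` controllable ones (`Sum.inl`) and `V` uncontrollable ones (`Sum.inr`). -/
abbrev Agent (N V : ℕ) : Type := Fin N ⊕ Fin V

/-- Stacked vectors in `ℝ^((N+V)n)`, one block in `ℝⁿ` for each agent, with the Euclidean norm. -/
abbrev Stacked (N V n : ℕ) : Type := PiLp 2 (fun _ : Agent N V => Vec n)

/-! ### Communication topology -/

/-- The undirected communication graph of the controllable agents (without self edges), and the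
relation "controllable agent `i` obtains the state of uncontrollable agent `l`". -/
structure Network (N V : ℕ) where
  graph : SimpleGraph (Fin N)
  sees : Fin N → Fin V → Prop

namespace Network

variable {N V : ℕ}

open Classical in
/-- The adjacency weights `a_{ij} ∈ {0, 1}`, for `i` controllable and `j` any agent. -/
def a (net : Network N V) (i : Fin N) : Agent N V → ℝ
  | Sum.inl j => if net.graph.Adj i j then 1 else 0
  | Sum.inr l => if net.sees i l then 1 else 0

/-- The pinning weights: `b_{ii} = 1` and `b_{ij} = a_{ij}` for `j ≠ i`. -/
def b (net : Network N V) (i : Fin N) (j : Agent N V) : ℝ :=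
  if j = Sum.inl i then 1 else net.a i j

/-- The communication graph is connected, and the state of each uncontrollable agent is obtained
by at least one controllable agent. -/
def IsConnected (net : Network N V) : Prop :=
  net.graph.Connected ∧ ∀ l : Fin V, ∃ i : Fin N, net.sees i l

end Network

/-! ### Agent dynamics `ẋ = f(x) + g(x) u` and the safe set -/

/-- Drift `f` and input matrix `g` (as a linear map `ℝᵐ → ℝⁿ` for each state). -/
structure Dynamics (n m : ℕ) where
  f : Vec n → Vec n
  g : Vec n → (Vec m →L[ℝ] Vec n)

/-- `f` is globally Lipschitz and `g` is locally Lipschitz. -/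
def Dynamics.IsRegular {n m : ℕ} (sys : Dynamics n m) : Prop :=
  (∃ L : NNReal, LipschitzWith L sys.f) ∧ LocallyLipschitz sys.g

/-- The safe set `{z | h z ≥ 0}`. -/
def safeSet {N V n : ℕ} (h : Stacked N V n → ℝ) : Set (Stacked N V n) := {z | 0 ≤ h z}

/-- `(∂h/∂x_j)(z) v`: the partial derivative in the block of agent `j`, applied to `v`. -/
def blockDeriv {N V n : ℕ} (h : Stacked N V n → ℝ) (z : Stacked N V n) (j : Agent N V)
    (v : Vec n) : ℝ :=
  fderiv ℝ h z (WithLp.toLp 2 (Pi.single j v))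

/-- Extended class `𝒦` functions: continuous, strictly increasing, zero at zero. -/
def IsExtendedClassK (α : ℝ → ℝ) : Prop :=
  Continuous α ∧ StrictMono α ∧ α 0 = 0

/-! ### Parameters of the scheme -/

/-- The parameters of the observer (`P`, `σ`), of the reconstructed barrier function
(`c`, `ϱ`, `ϵ`, `ς`, `γ`, `ρ₀`, `ρinf`) and of the local quadratic program (`W`, `α`). -/
structure Params (N V n m : ℕ) where
  P : Agent N V → Matrix (Fin n) (Fin n) ℝ
  σ : Agent N V → ℝ
  c : Fin N → ℝ
  ϱ : ℝ
  ϵ : Fin N → ℝ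
  ς : Fin N → ℝ
  γ : Fin N → ℝ
  ρ₀ : Fin N → ℝ
  ρinf : Fin N → ℝ
  W : Fin N → Matrix (Fin m) (Fin m) ℝ
  α : Fin N → ℝ → ℝ

/-- The sign and definiteness conditions under which the parameters are chosen. -/
structure Params.IsAdmissible {N V n m : ℕ} (p : Params N V n m) : Prop where
  P_posDef : ∀ l, (p.P l).PosDef
  σ_pos : ∀ l, 0 < p.σ l
  c_pos : ∀ i, 0 < p.c i
  ϱ_pos : 0 < p.ϱ
  ϵ_pos : ∀ i, 0 < p.ϵ i
  ς_pos : ∀ i, 0 < p.ς i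
  γ_pos : ∀ i, 0 < p.γ i
  ρinf_pos : ∀ i, 0 < p.ρinf i
  ρinf_lt : ∀ i, p.ρinf i < p.ρ₀ i
  W_posDef : ∀ i, (p.W i).PosDef
  α_classK : ∀ i, IsExtendedClassK (p.α i)

/-- The performance function `ρ_i(t) = (ρ₀ⁱ - ρ_∞ⁱ) e^{-ϱ t} + ρ_∞ⁱ`. -/
def Params.ρ {N V n m : ℕ} (p : Params N V n m) (i : Fin N) (t : ℝ) : ℝ :=
  (p.ρ₀ i - p.ρinf i) * Real.exp (-p.ϱ * t) + p.ρinf i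

/-! ### State of the closed loop and the signals computed from it -/

/-- The closed-loop state: the agents' states `x`, the estimates `x̂_{i,l}` and adaptive gains
`δ̂_{i,l}` of the observers, and the adaptive parameters `ϑ_i` and `r̂_i`. -/
structure State (N V n : ℕ) where
  x : Stacked N V n
  xhat : Fin N → Agent N V → Vec n
  δhat : Fin N → Agent N V → ℝ
  ϑ : Fin N → ℝ
  rhat : Fin N → ℝ

namespace State

variable {N V n m : ℕ}

/-- `ξ_{i,l} = ∑_{j=1}^N a_{ij} (x̂_{i,l} - x̂_{j,l}) + b_{il} (x̂_{i,l} - x_l)`. -/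
def ξ (net : Network N V) (s : State N V n) (i : Fin N) (l : Agent N V) : Vec n :=
  ∑ j : Fin N, net.a i (Sum.inl j) • (s.xhat i l - s.xhat j l)
    + net.b i l • (s.xhat i l - s.x l)

/-- Right-hand side of the observer equation for `x̂_{i,l}`: `f(x̂_{i,l}) - δ̂_{i,l} ξ_{i,l}`. -/
def xhatRate (net : Network N V) (sys : Dynamics n m) (s : State N V n) (i : Fin N)
    (l : Agent N V) : Vec n :=
  sys.f (s.xhat i l) - s.δhat i l • s.ξ net i l

/-- Right-hand side for `δ̂_{i,l}`: `2 ξ_{i,l}ᵀ P_l ξ_{i,l} - σ_l δ̂_{i,l}`. -/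
def δhatRate (net : Network N V) (p : Params N V n m) (s : State N V n) (i : Fin N)
    (l : Agent N V) : ℝ :=
  2 * ((s.ξ net i l).ofLp ⬝ᵥ (p.P l).mulVec (s.ξ net i l).ofLp) - p.σ l * s.δhat i l

/-- `υ̂_i`: the stacked state in which every block `x_j`, `j ≠ i`, is replaced by the
estimate `x̂_{i,j}`. -/
def υhat (s : State N V n) (i : Fin N) : Stacked N V n :=
  WithLp.toLp 2 fun j => if j = Sum.inl i then s.x j else s.xhat i j

/-- The reconstructed barrier function `ĥ_i = h(υ̂_i) - ϑ_i`. -/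
def hhat (h : Stacked N V n → ℝ) (s : State N V n) (i : Fin N) : ℝ :=
  h (s.υhat i) - s.ϑ i

/-- The reconstruction error `e_i = h(x) - ĥ_i`. -/
def e (h : Stacked N V n → ℝ) (s : State N V n) (i : Fin N) : ℝ :=
  h s.x - s.hhat h i

/-- The transformed error `ε_i = (1/2) ln (e_i / (ρ_i - e_i))`. -/
def ε (h : Stacked N V n → ℝ) (p : Params N V n m) (t : ℝ) (s : State N V n) (i : Fin N) : ℝ :=
  1 / 2 * Real.log (s.e h i / (p.ρ i t - s.e h i))

/-- `‖dh(υ̂_i)/dυ̂_i‖ + ‖d/dt (x̂_{i,1}, …, x̂_{i,N+V})‖`. -/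
def rateNorm (net : Network N V) (sys : Dynamics n m) (h : Stacked N V n → ℝ)
    (s : State N V n) (i : Fin N) : ℝ :=
  ‖fderiv ℝ h (s.υhat i)‖
    + ‖(WithLp.toLp 2 (fun l => s.xhatRate net sys i l) : Stacked N V n)‖

/-- `χ_i = ε_i ρ_i / (2 e_i (ρ_i - e_i)) * rateNorm`. -/
def χ (net : Network N V) (sys : Dynamics n m) (h : Stacked N V n → ℝ) (p : Params N V n m)
    (t : ℝ) (s : State N V n) (i : Fin N) : ℝ :=
  s.ε h p t i * p.ρ i t / (2 * s.e h i * (p.ρ i t - s.e h i)) * s.rateNorm net sys h i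

/-- Right-hand side of the equation for `ϑ_i`. -/
def ϑRate (net : Network N V) (sys : Dynamics n m) (h : Stacked N V n → ℝ)
    (p : Params N V n m) (t : ℝ) (s : State N V n) (i : Fin N) : ℝ :=
  - p.c i * (s.e h i * (p.ρ i t - s.e h i) / p.ρ i t) * s.ε h p t i
    - p.ϱ * s.e h i / p.ρ i t * (p.ρ₀ i - p.ρinf i) * Real.exp (-p.ϱ * t)
    - p.ρ i t * s.ε h p t i / (4 * s.e h i * (p.ρ i t - s.e h i))
    - s.rhat i ^ 2 * s.rateNorm net sys h i * s.χ net sys h p t i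
        / Real.sqrt (s.χ net sys h p t i ^ 2 * s.rhat i ^ 2 + p.ϵ i ^ 2)

/-- Right-hand side of the equation for `r̂_i`. -/
def rhatRate (net : Network N V) (sys : Dynamics n m) (h : Stacked N V n → ℝ)
    (p : Params N V n m) (t : ℝ) (s : State N V n) (i : Fin N) : ℝ :=
  p.γ i * |s.ε h p t i| * p.ρ i t / (2 * s.e h i * (p.ρ i t - s.e h i))
      * s.rateNorm net sys h i
    - p.ς i * s.rhat i

/-- The performance bounds `0 < e_i < ρ_i`. This is where `ε_i`, and with it the adaptive laws
and the local quadratic program of agent `i`, are defined. -/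
def InBounds (h : Stacked N V n → ℝ) (p : Params N V n m) (t : ℝ) (s : State N V n)
    (i : Fin N) : Prop :=
  0 < s.e h i ∧ s.e h i < p.ρ i t

/-! ### The local quadratic program -/

/-- Left-hand side of the constraint of agent `i`, at the candidate input `ν`:
`∂ĥ_i/∂x_i (f(x_i) + g(x_i) ν) + ∑_{l ≠ i} ∂ĥ_i/∂x̂_{i,l} (d/dt x̂_{i,l}) - d/dt ϑ_i`. -/
def constraintLHS (net : Network N V) (sys : Dynamics n m) (h : Stacked N V n → ℝ)
    (p : Params N V n m) (t : ℝ) (s : State N V n) (i : Fin N) (ν : Vec m) : ℝ :=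
  blockDeriv h (s.υhat i) (Sum.inl i) (sys.f (s.x (Sum.inl i)) + sys.g (s.x (Sum.inl i)) ν)
    + ∑ l ∈ Finset.univ.erase (Sum.inl i : Agent N V),
        blockDeriv h (s.υhat i) l (s.xhatRate net sys i l)
    - s.ϑRate net sys h p t i

/-- The feasible inputs of agent `i`: those with `constraintLHS ≥ - α_i(ĥ_i)`. -/
def feasible (net : Network N V) (sys : Dynamics n m) (h : Stacked N V n → ℝ)
    (p : Params N V n m) (t : ℝ) (s : State N V n) (i : Fin N) : Set (Vec m) :=
  {ν | - p.α i (s.hhat h i) ≤ s.constraintLHS net sys h p t i ν}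

end State

/-- The cost `(1/2) (ν - u_nom)ᵀ W_i (ν - u_nom)`. -/
def qpCost {N V n m : ℕ} (p : Params N V n m) (i : Fin N) (unom ν : Vec m) : ℝ :=
  1 / 2 * ((ν - unom).ofLp ⬝ᵥ (p.W i).mulVec (ν - unom).ofLp)

/-- `u` solves the local quadratic program of agent `i`: it is feasible and minimizes the cost
among the feasible inputs. -/
def IsQPSolution {N V n m : ℕ} (net : Network N V) (sys : Dynamics n m)
    (h : Stacked N V n → ℝ) (p : Params N V n m) (t : ℝ) (s : State N V n) (i : Fin N)
    (unom u : Vec m) : Prop :=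
  u ∈ s.feasible net sys h p t i ∧ IsMinOn (qpCost p i unom) (s.feasible net sys h p t i) u

/-! ### Closed-loop trajectories -/

/-- The time interval `[0, T)`, where `T = ⊤` is allowed. -/
def horizon (T : EReal) : Set ℝ := {t | 0 ≤ t ∧ (t : EReal) < T}

/-- `s` is a trajectory on `[0, T)` of the closed loop with inputs `u` and nominal inputs `unom`.

All signals are continuous and the differential equations hold with right derivatives at each time;
this comprises all classical solutions, and also solutions with, say, piecewise continuous
inputs. The inputs of the uncontrollable agents are arbitrary. The adaptive laws and the quadratic
program of agent `i` are imposed at those times at which `0 < e_i < ρ_i`, since their formulas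
are undefined at other times; it is not required that these bounds hold for positive times. -/
structure IsClosedLoop {N V n m : ℕ} (net : Network N V) (sys : Dynamics n m)
    (h : Stacked N V n → ℝ) (p : Params N V n m) (T : EReal) (s : ℝ → State N V n)
    (u : ℝ → Agent N V → Vec m) (unom : ℝ → Fin N → Vec m) : Prop where
  x_cont : ContinuousOn (fun t => (s t).x) (horizon T)
  xhat_cont : ∀ i l, ContinuousOn (fun t => (s t).xhat i l) (horizon T)
  δhat_cont : ∀ i l, ContinuousOn (fun t => (s t).δhat i l) (horizon T)
  ϑ_cont : ∀ i, ContinuousOn (fun t => (s t).ϑ i) (horizon T)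
  rhat_cont : ∀ i, ContinuousOn (fun t => (s t).rhat i) (horizon T)
  /-- The agents: `ẋ_i = f(x_i) + g(x_i) u_i`. -/
  x_deriv : ∀ t ∈ horizon T, ∀ j, HasDerivWithinAt (fun τ => (s τ).x j)
    (sys.f ((s t).x j) + sys.g ((s t).x j) (u t j)) (Set.Ici t) t
  /-- The distributed adaptive observers. -/
  xhat_deriv : ∀ t ∈ horizon T, ∀ i l, HasDerivWithinAt (fun τ => (s τ).xhat i l)
    ((s t).xhatRate net sys i l) (Set.Ici t) t
  δhat_deriv : ∀ t ∈ horizon T, ∀ i l, HasDerivWithinAt (fun τ => (s τ).δhat i l)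
    ((s t).δhatRate net p i l) (Set.Ici t) t
  /-- The adaptive laws of the reconstructed barrier functions. -/
  ϑ_deriv : ∀ t ∈ horizon T, ∀ i, (s t).InBounds h p t i →
    HasDerivWithinAt (fun τ => (s τ).ϑ i) ((s t).ϑRate net sys h p t i) (Set.Ici t) t
  rhat_deriv : ∀ t ∈ horizon T, ∀ i, (s t).InBounds h p t i →
    HasDerivWithinAt (fun τ => (s τ).rhat i) ((s t).rhatRate net sys h p t i) (Set.Ici t) t
  /-- The inputs of the controllable agents are computed by the local quadratic programs. -/
  input_qp : ∀ t ∈ horizon T, ∀ i, (s t).InBounds h p t i →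
    IsQPSolution net sys h p t (s t) i (unom t i) (u t (Sum.inl i))

/-- The choice of the initial values: `0 < e_i(0) < ρ₀ⁱ` and `ĥ_i(0) ≥ 0`. -/
def IsInitialized {N V n m : ℕ} (h : Stacked N V n → ℝ) (p : Params N V n m)
    (s₀ : State N V n) : Prop :=
  ∀ i, 0 < s₀.e h i ∧ s₀.e h i < p.ρ₀ i ∧ 0 ≤ s₀.hhat h i

end SafeMAS

end

/-! By definition `h x = ĥ_i + e_i`, so a single controllable agent `i` with `ĥ_i ≥ 0` and `e_i > 0`
certifies safety; how well the observers track the states plays no role.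

The bound `0 < e_i < ρ_i` (`IsClosedLoop.inBounds`) is a barrier argument. On a compact time
interval `ė_i` equals the rate of `ϑ_i` plus a bounded perturbation. The term `-ρ_i ε_i / (4 e_i
(ρ_i - e_i))` of that rate blows up at both ends of `(0, ρ_i)` and points inwards (`le_ϑRate`,
`ϑRate_le`). Hence for small `δ` the tube `δ ≤ e_i ≤ ρ_i - δ` cannot be left. The tube lies strictly
inside the region where the adaptive laws are in force, so there is no circularity.

Once the bounds hold, the program constraint says exactly that the right derivative of `ĥ_i` is at
least `-α_i(ĥ_i)`, and comparison gives `ĥ_i ≥ 0` (`IsClosedLoop.hhat_nonneg`). -/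

/-! ### Differential inequalities with right derivatives -/

/-- A function that vanishes at `t` and has a positive right derivative there is nonnegative on a
right neighbourhood of `t`. -/
theorem HasDerivWithinAt.eventually_nonneg_right {φ : ℝ → ℝ} {φ' t : ℝ}
    (hφ : HasDerivWithinAt φ φ' (Set.Ici t) t) (h0 : φ t = 0) (hpos : 0 < φ') :
    ∀ᶠ τ in nhdsWithin t (Set.Ioi t), 0 ≤ φ τ := by
  have hs := (hasDerivWithinAt_iff_tendsto_slope' (Set.self_notMem_Ioi)).1
    (hφ.mono Set.Ioi_subset_Ici_self)
  filter_upwards [hs.eventually (lt_mem_nhds hpos), self_mem_nhdsWithin] with τ h1 h2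
  rw [slope_def_field, h0, sub_zero] at h1
  exact ((div_pos_iff_of_pos_right (sub_pos.2 h2)).1 h1).le

/-- A region `{φ ≥ 0} ∩ {ψ ≥ 0}` is forward invariant if the right derivatives point strictly
inwards on its boundary. -/
theorem nonneg_of_right_deriv_inward {φ ψ : ℝ → ℝ} {a b : ℝ}
    (hφ : ContinuousOn φ (Set.Icc a b)) (hψ : ContinuousOn ψ (Set.Icc a b))
    (hφa : 0 ≤ φ a) (hψa : 0 ≤ ψ a)
    (hφ' : ∀ t ∈ Set.Ico a b, φ t = 0 → 0 ≤ ψ t →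
      ∃ φ', 0 < φ' ∧ HasDerivWithinAt φ φ' (Set.Ici t) t)
    (hψ' : ∀ t ∈ Set.Ico a b, ψ t = 0 → 0 ≤ φ t →
      ∃ ψ', 0 < ψ' ∧ HasDerivWithinAt ψ ψ' (Set.Ici t) t) :
    ∀ t ∈ Set.Icc a b, 0 ≤ φ t ∧ 0 ≤ ψ t := by
  have hclosed : IsClosed ({t | 0 ≤ φ t ∧ 0 ≤ ψ t} ∩ Set.Icc a b) := by
    have h1 := hφ.preimage_isClosed_of_isClosed isClosed_Icc (isClosed_Ici (a := (0 : ℝ)))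
    have h2 := hψ.preimage_isClosed_of_isClosed isClosed_Icc (isClosed_Ici (a := (0 : ℝ)))
    convert h1.inter h2 using 1
    ext t
    simp only [Set.mem_inter_iff, Set.mem_ofPred_eq, Set.mem_preimage, Set.mem_Ici]
    tauto
  have hstep : ∀ η : ℝ → ℝ, ContinuousOn η (Set.Icc a b) → ∀ t ∈ Set.Ico a b, 0 ≤ η t →
      (η t = 0 → ∃ η', 0 < η' ∧ HasDerivWithinAt η η' (Set.Ici t) t) →
      ∀ᶠ τ in nhdsWithin t (Set.Ioi t), 0 ≤ η τ := by
    intro η hη t ht h0 hη'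
    rcases h0.eq_or_lt with h0 | h0
    · obtain ⟨η', hpos, hd⟩ := hη' h0.symm
      exact hd.eventually_nonneg_right h0.symm hpos
    · have hc : ContinuousWithinAt η (Set.Ioi t) t :=
        (hη t (Set.Ico_subset_Icc_self ht)).mono_of_mem_nhdsWithin
          (Icc_mem_nhdsGT_of_mem ht)
      exact (hc.eventually (lt_mem_nhds h0)).mono fun _ h => h.le
  -- Continuous induction on `[a, b]`: the good set is closed, contains `a`, and extends to the
  -- right of each of its points before `b`.
  exact hclosed.Icc_subset_of_forall_mem_nhdsWithin ⟨hφa, hψa⟩ fun t ⟨⟨h1, h2⟩, ht⟩ =>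
    (hstep φ hφ t ht h1 fun h => hφ' t ht h h2).and (hstep ψ hψ t ht h2 fun h => hψ' t ht h h1)

/-- Comparison principle: `φ' ≥ -α(φ)` with `α` strictly increasing and `α 0 = 0` keeps `φ`
nonnegative. -/
theorem nonneg_of_right_deriv_ge_neg_classK {φ φ' : ℝ → ℝ} {α : ℝ → ℝ} {a b : ℝ}
    (hα : StrictMono α) (hα0 : α 0 = 0) (hφ : ContinuousOn φ (Set.Icc a b)) (hφa : 0 ≤ φ a)
    (hd : ∀ t ∈ Set.Icc a b, HasDerivWithinAt φ (φ' t) (Set.Ici t) t)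
    (hge : ∀ t ∈ Set.Icc a b, -α (φ t) ≤ φ' t) :
    ∀ t ∈ Set.Icc a b, 0 ≤ φ t := by
  intro t ht
  -- At level `0` the inequality only gives `φ' ≥ 0`, which is not strictly inward. At level `-η` it
  -- gives `φ' ≥ -α(-η) > 0`, so `φ ≥ -η` is invariant for every `η > 0`.
  refine le_of_forall_pos_le_add fun η hη => ?_
  have hin : ∀ τ ∈ Set.Ico a b, φ τ + η = 0 → 0 ≤ φ τ + η →
      ∃ ψ', 0 < ψ' ∧ HasDerivWithinAt (fun r => φ r + η) ψ' (Set.Ici τ) τ := by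
    intro τ hτ h0 _
    have hτ' := Set.Ico_subset_Icc_self hτ
    refine ⟨φ' τ, ?_, (hd τ hτ').add_const η⟩
    have h1 := hα (show φ τ < 0 by linarith)
    have h2 := hge τ hτ'
    linarith
  have hc : ContinuousOn (fun r => φ r + η) (Set.Icc a b) := hφ.add continuousOn_const
  exact (nonneg_of_right_deriv_inward hc hc (by linarith) (by linarith) hin hin t ht).1

/-! ### Continuity of linear combinations -/

theorem continuousOn_smul_normed {E : Type*} [NormedAddCommGroup E] [NormedSpace ℝ E]
    {a : ℝ → ℝ} {y : ℝ → E} {S : Set ℝ} (ha : ContinuousOn a S) (hy : ContinuousOn y S) :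
    ContinuousOn (fun t => a t • y t) S :=
  ha.smul hy

theorem continuousOn_sum_smul_sub_add_smul_sub {E ι : Type*} [NormedAddCommGroup E]
    [NormedSpace ℝ E] [Fintype ι] {y : ι → ℝ → E} {w : ℝ → E} {S : Set ℝ}
    (hy : ∀ j, ContinuousOn (y j) S) (hw : ContinuousOn w S) (a : ι → ℝ) (b : ℝ) (i : ι) :
    ContinuousOn (fun t => ∑ j, a j • (y i t - y j t) + b • (y i t - w t)) S :=
  (continuousOn_finsetSum _ fun j _ => ((hy i).sub (hy j)).const_smul _).add
    (((hy i).sub hw).const_smul _)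

/-! ### Chain rule for functions of stacked vectors -/

theorem hasDerivWithinAt_comp_piLp {ι : Type*} [Fintype ι] {E : ι → Type*}
    [∀ j, NormedAddCommGroup (E j)] [∀ j, NormedSpace ℝ (E j)] {h : PiLp 2 E → ℝ}
    (hh : Differentiable ℝ h) {z : ℝ → PiLp 2 E} {v : PiLp 2 E} {S : Set ℝ} {t : ℝ}
    (hz : ∀ j, HasDerivWithinAt (fun τ => z τ j) (v j) S t) :
    HasDerivWithinAt (fun τ => h (z τ)) (fderiv ℝ h (z t) v) S t := by
  have hzv : HasDerivWithinAt z v S t := by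
    rw [hasDerivWithinAt_iff_hasFDerivWithinAt, hasFDerivWithinAt_piLp]
    intro j
    refine (hz j).hasFDerivWithinAt.congr_fderiv ?_
    ext1
    simp
  exact (hh (z t)).hasFDerivAt.comp_hasDerivWithinAt t hzv

namespace SafeMAS

variable {N V n m : ℕ}

/-! ### Block decomposition of the derivative -/

theorem fderiv_apply_eq_sum_blockDeriv (h : Stacked N V n → ℝ) (z v : Stacked N V n) :
    fderiv ℝ h z v = ∑ j, blockDeriv h z j (v j) := by
  have hv : v = ∑ j, (WithLp.toLp 2 (Pi.single j (v j)) : Stacked N V n) := by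
    rw [← WithLp.toLp_sum, Finset.univ_sum_single]
  conv_lhs => rw [hv, map_sum]
  rfl

theorem abs_blockDeriv_le (h : Stacked N V n → ℝ) (z : Stacked N V n) (j : Agent N V)
    (v : Vec n) : |blockDeriv h z j v| ≤ ‖fderiv ℝ h z‖ * ‖v‖ := by
  have := (fderiv ℝ h z).le_opNorm (WithLp.toLp 2 (Pi.single j v))
  rwa [PiLp.toLp_single, PiLp.norm_single] at this

/-- Only boundedness of the blocks of `v` is asked, since velocities containing the inputs need not
be continuous in time. -/
theorem exists_abs_fderiv_le {h : Stacked N V n → ℝ} (hh : ContDiff ℝ 1 h) {K : Set ℝ}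
    (hK : IsCompact K) {z v : ℝ → Stacked N V n} (hz : ContinuousOn z K)
    (hv : ∀ j, ∃ C, ∀ t ∈ K, ‖v t j‖ ≤ C) :
    ∃ C, ∀ t ∈ K, |fderiv ℝ h (z t) (v t)| ≤ C := by
  obtain ⟨B, hB⟩ := hK.exists_bound_of_continuousOn
    ((hh.continuous_fderiv one_ne_zero).comp_continuousOn hz)
  choose C hC using hv
  refine ⟨∑ j, B * C j, fun t ht => ?_⟩
  rw [fderiv_apply_eq_sum_blockDeriv]
  refine (Finset.abs_sum_le_sum_abs _ _).trans (Finset.sum_le_sum fun j _ => ?_)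
  exact (abs_blockDeriv_le h _ j _).trans
    (mul_le_mul (hB t ht) (hC j t ht) (norm_nonneg _) ((norm_nonneg _).trans (hB t ht)))

/-! ### The performance function -/

theorem Params.ρ_zero (p : Params N V n m) (i : Fin N) : p.ρ i 0 = p.ρ₀ i := by
  simp [Params.ρ]

theorem Params.IsAdmissible.ρinf_lt_ρ {p : Params N V n m} (hp : p.IsAdmissible) (i : Fin N)
    (t : ℝ) : p.ρinf i < p.ρ i t := by
  have := mul_pos (sub_pos.2 (hp.ρinf_lt i)) (Real.exp_pos (-p.ϱ * t))
  unfold Params.ρ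
  linarith

theorem Params.hasDerivAt_ρ (p : Params N V n m) (i : Fin N) (t : ℝ) :
    HasDerivAt (p.ρ i) (-(p.ϱ * ((p.ρ₀ i - p.ρinf i) * Real.exp (-p.ϱ * t)))) t := by
  have h1 : HasDerivAt (fun τ => -p.ϱ * τ) (-p.ϱ) t := by
    simpa using (hasDerivAt_id t).const_mul (-p.ϱ)
  exact ((h1.exp.const_mul (p.ρ₀ i - p.ρinf i)).add_const (p.ρinf i)).congr_deriv (by ring)

/-- The quantity is `-ρ̇_i`. It enters both the adaptive law and the motion of the upper performance
bound. -/
theorem Params.IsAdmissible.decay_mem_Icc {p : Params N V n m} (hp : p.IsAdmissible) (i : Fin N)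
    {t : ℝ} (ht : 0 ≤ t) :
    p.ϱ * ((p.ρ₀ i - p.ρinf i) * Real.exp (-p.ϱ * t)) ∈
      Set.Icc 0 (p.ϱ * (p.ρ₀ i - p.ρinf i)) := by
  have h1 := hp.ϱ_pos
  have h2 := sub_pos.2 (hp.ρinf_lt i)
  have h3 : Real.exp (-p.ϱ * t) ≤ 1 := Real.exp_le_one_iff.2 (by nlinarith)
  exact ⟨by positivity, mul_le_mul_of_nonneg_left (mul_le_of_le_one_right h2.le h3) h1.le⟩

namespace State

/-! ### Sign of the adaptive law near the performance bounds -/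

theorem rateNorm_nonneg (net : Network N V) (sys : Dynamics n m) (h : Stacked N V n → ℝ)
    (s : State N V n) (i : Fin N) : 0 ≤ s.rateNorm net sys h i := by
  unfold rateNorm
  positivity

/-- For negative `ε_i` all terms but the decay term are nonnegative, `χ_i` having the sign of `ε_i`.
The third is at least `ρ_i / (8 e_i (ρ_i - e_i)) ≥ 1 / (8 e_i)`, and the decay term costs at most
its uniform bound because `e_i / ρ_i < 1`. -/
theorem le_ϑRate {net : Network N V} {sys : Dynamics n m} {h : Stacked N V n → ℝ}
    {p : Params N V n m} (hp : p.IsAdmissible) {t : ℝ} (ht : 0 ≤ t) {s : State N V n} {i : Fin N}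
    (hb : s.InBounds h p t i) (hε : s.ε h p t i ≤ -(1 / 2)) :
    1 / (8 * s.e h i) - p.ϱ * (p.ρ₀ i - p.ρinf i) ≤ s.ϑRate net sys h p t i := by
  obtain ⟨he, heρ⟩ := hb
  have hd : 0 < p.ρ i t - s.e h i := sub_pos.2 heρ
  have hρ : 0 < p.ρ i t := he.trans heρ
  have hM := s.rateNorm_nonneg net sys h i
  have hc := hp.c_pos i
  have hdec := hp.decay_mem_Icc i ht
  have h1 : 0 ≤ - p.c i * (s.e h i * (p.ρ i t - s.e h i) / p.ρ i t) * s.ε h p t i :=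
    mul_nonneg_of_nonpos_of_nonpos
      (mul_nonpos_of_nonpos_of_nonneg (by linarith) (by positivity)) (by linarith)
  have h2 : p.ϱ * s.e h i / p.ρ i t * (p.ρ₀ i - p.ρinf i) * Real.exp (-p.ϱ * t)
      ≤ p.ϱ * (p.ρ₀ i - p.ρinf i) := by
    calc _ = s.e h i / p.ρ i t * (p.ϱ * ((p.ρ₀ i - p.ρinf i) * Real.exp (-p.ϱ * t))) := by ring
      _ ≤ p.ϱ * ((p.ρ₀ i - p.ρinf i) * Real.exp (-p.ϱ * t)) :=
        mul_le_of_le_one_left hdec.1 ((div_le_one hρ).2 heρ.le)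
      _ ≤ _ := hdec.2
  have h3 : p.ρ i t * s.ε h p t i / (4 * s.e h i * (p.ρ i t - s.e h i))
      ≤ -(1 / (8 * s.e h i)) := by
    rw [← neg_div, div_le_div_iff₀ (by positivity) (by positivity)]
    nlinarith [mul_le_mul_of_nonneg_left hε (mul_pos hρ he).le, mul_pos he he]
  have hχ : s.χ net sys h p t i ≤ 0 := by
    unfold χ
    refine mul_nonpos_of_nonpos_of_nonneg (div_nonpos_of_nonpos_of_nonneg
      (mul_nonpos_of_nonpos_of_nonneg (by linarith) hρ.le) (by positivity)) hM
  have h4 : s.rhat i ^ 2 * s.rateNorm net sys h i * s.χ net sys h p t i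
        / Real.sqrt (s.χ net sys h p t i ^ 2 * s.rhat i ^ 2 + p.ϵ i ^ 2) ≤ 0 :=
    div_nonpos_of_nonpos_of_nonneg
      (mul_nonpos_of_nonneg_of_nonpos (by positivity) hχ) (Real.sqrt_nonneg _)
  unfold ϑRate
  linarith

/-- Mirror image at the upper bound, using `ρ_i / e_i ≥ 1`. Here the decay term also has the
favourable sign, so no constant is lost. -/
theorem ϑRate_le {net : Network N V} {sys : Dynamics n m} {h : Stacked N V n → ℝ}
    {p : Params N V n m} (hp : p.IsAdmissible) {t : ℝ} (ht : 0 ≤ t) {s : State N V n} {i : Fin N}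
    (hb : s.InBounds h p t i) (hε : 1 / 2 ≤ s.ε h p t i) :
    s.ϑRate net sys h p t i ≤ -(1 / (8 * (p.ρ i t - s.e h i))) := by
  obtain ⟨he, heρ⟩ := hb
  have hd : 0 < p.ρ i t - s.e h i := sub_pos.2 heρ
  have hρ : 0 < p.ρ i t := he.trans heρ
  have hM := s.rateNorm_nonneg net sys h i
  have hε0 : 0 < s.ε h p t i := by linarith
  have h1 : 0 ≤ p.c i * (s.e h i * (p.ρ i t - s.e h i) / p.ρ i t) * s.ε h p t i := by
    have := hp.c_pos i
    positivity
  have h2 : 0 ≤ p.ϱ * s.e h i / p.ρ i t * (p.ρ₀ i - p.ρinf i) * Real.exp (-p.ϱ * t) := by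
    calc 0 ≤ s.e h i / p.ρ i t * (p.ϱ * ((p.ρ₀ i - p.ρinf i) * Real.exp (-p.ϱ * t))) :=
          mul_nonneg (by positivity) (hp.decay_mem_Icc i ht).1
      _ = _ := by ring
  have h3 : 1 / (8 * (p.ρ i t - s.e h i))
      ≤ p.ρ i t * s.ε h p t i / (4 * s.e h i * (p.ρ i t - s.e h i)) := by
    rw [div_le_div_iff₀ (by positivity) (by positivity)]
    nlinarith [mul_le_mul_of_nonneg_left hε (mul_pos hρ hd).le, mul_pos hd hd]
  have h4 : 0 ≤ s.rhat i ^ 2 * s.rateNorm net sys h i * s.χ net sys h p t i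
        / Real.sqrt (s.χ net sys h p t i ^ 2 * s.rhat i ^ 2 + p.ϵ i ^ 2) := by
    have : 0 ≤ s.χ net sys h p t i := by
      unfold χ
      positivity
    positivity
  unfold ϑRate
  linarith

/-- The quotient inside the logarithm is at most `1/3`, and `Real.exp 1 < 3`. -/
theorem ε_le_neg_half {h : Stacked N V n → ℝ} {p : Params N V n m} {t : ℝ} {s : State N V n}
    {i : Fin N} (he : 0 < s.e h i) (hsmall : 4 * s.e h i ≤ p.ρ i t) :
    s.ε h p t i ≤ -(1 / 2) := by
  have hd : 0 < p.ρ i t - s.e h i := by linarith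
  have hexp : s.e h i / (p.ρ i t - s.e h i) ≤ Real.exp (-1) := by
    rw [Real.exp_neg, div_le_iff₀ hd, inv_mul_eq_div, le_div_iff₀ (Real.exp_pos _)]
    nlinarith [Real.exp_one_lt_d9]
  have := (Real.log_le_iff_le_exp (div_pos he hd)).2 hexp
  unfold ε
  linarith

theorem half_le_ε {h : Stacked N V n → ℝ} {p : Params N V n m} {t : ℝ} {s : State N V n}
    {i : Fin N} (he : s.e h i < p.ρ i t) (hsmall : 4 * (p.ρ i t - s.e h i) ≤ p.ρ i t) :
    1 / 2 ≤ s.ε h p t i := by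
  have hd : 0 < p.ρ i t - s.e h i := sub_pos.2 he
  have hexp : Real.exp 1 ≤ s.e h i / (p.ρ i t - s.e h i) := by
    rw [le_div_iff₀ hd]
    nlinarith [Real.exp_one_lt_d9]
  have := (Real.le_log_iff_exp_le (div_pos (by linarith) hd)).2 hexp
  unfold ε
  linarith

/-! ### Velocity of the stacked estimate -/

/-- The velocity of `υ̂_i` when the velocity of `x_i` is `w`. -/
noncomputable def υhatRate (net : Network N V) (sys : Dynamics n m) (s : State N V n) (i : Fin N) (w : Vec n) :
    Stacked N V n :=
  WithLp.toLp 2 fun j => if j = Sum.inl i then w else s.xhatRate net sys i j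

/-- Identifies the constraint expression at the applied input with the velocity of `ĥ_i` along the
trajectory, which turns feasibility into a differential inequality. -/
theorem constraintLHS_eq (net : Network N V) (sys : Dynamics n m) (h : Stacked N V n → ℝ)
    (p : Params N V n m) (t : ℝ) (s : State N V n) (i : Fin N) (ν : Vec m) :
    s.constraintLHS net sys h p t i ν =
      fderiv ℝ h (s.υhat i) (s.υhatRate net sys i
        (sys.f (s.x (Sum.inl i)) + sys.g (s.x (Sum.inl i)) ν)) - s.ϑRate net sys h p t i := by
  rw [fderiv_apply_eq_sum_blockDeriv,
    ← Finset.add_sum_erase _ _ (Finset.mem_univ (Sum.inl i : Agent N V))]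
  unfold constraintLHS υhatRate
  congr 2
  · simp
  · refine Finset.sum_congr rfl fun l hl => ?_
    simp [Finset.ne_of_mem_erase hl]

end State

/-! ### Regularity and invariance along closed-loop trajectories -/

namespace IsClosedLoop

variable {net : Network N V} {sys : Dynamics n m} {h : Stacked N V n → ℝ} {p : Params N V n m}
  {T : EReal} {s : ℝ → State N V n} {u : ℝ → Agent N V → Vec m} {unom : ℝ → Fin N → Vec m}

theorem continuousOn_x_apply (hloop : IsClosedLoop net sys h p T s u unom) (j : Agent N V) :
    ContinuousOn (fun t => (s t).x j) (horizon T) :=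
  (PiLp.continuous_apply 2 _ j).comp_continuousOn hloop.x_cont

theorem continuousOn_ξ (hloop : IsClosedLoop net sys h p T s u unom) (i : Fin N)
    (l : Agent N V) : ContinuousOn (fun t => (s t).ξ net i l) (horizon T) :=
  continuousOn_sum_smul_sub_add_smul_sub (fun j => hloop.xhat_cont j l)
    (hloop.continuousOn_x_apply l) _ _ i

theorem continuousOn_xhatRate (hloop : IsClosedLoop net sys h p T s u unom)
    (hf : Continuous sys.f) (i : Fin N) (l : Agent N V) :
    ContinuousOn (fun t => (s t).xhatRate net sys i l) (horizon T) :=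
  (hf.comp_continuousOn (hloop.xhat_cont i l)).sub
    (continuousOn_smul_normed (hloop.δhat_cont i l) (hloop.continuousOn_ξ i l))

theorem continuousOn_υhat (hloop : IsClosedLoop net sys h p T s u unom) (i : Fin N) :
    ContinuousOn (fun t => (s t).υhat i) (horizon T) := by
  refine (PiLp.continuous_toLp 2 _).comp_continuousOn (continuousOn_pi.2 fun j => ?_)
  by_cases hj : j = Sum.inl i
  · simpa only [hj, if_true] using hloop.continuousOn_x_apply (Sum.inl i)
  · simpa only [hj, if_false] using hloop.xhat_cont i j

theorem hasDerivWithinAt_h_x (hloop : IsClosedLoop net sys h p T s u unom)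
    (hh : Differentiable ℝ h) {t : ℝ} (ht : t ∈ horizon T) :
    HasDerivWithinAt (fun τ => h (s τ).x)
      (fderiv ℝ h (s t).x
        (WithLp.toLp 2 fun j => sys.f ((s t).x j) + sys.g ((s t).x j) (u t j)))
      (Set.Ici t) t :=
  hasDerivWithinAt_comp_piLp hh fun j => hloop.x_deriv t ht j

theorem hasDerivWithinAt_h_υhat (hloop : IsClosedLoop net sys h p T s u unom)
    (hh : Differentiable ℝ h) {t : ℝ} (ht : t ∈ horizon T) (i : Fin N) :
    HasDerivWithinAt (fun τ => h ((s τ).υhat i))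
      (fderiv ℝ h ((s t).υhat i) ((s t).υhatRate net sys i
        (sys.f ((s t).x (Sum.inl i)) + sys.g ((s t).x (Sum.inl i)) (u t (Sum.inl i)))))
      (Set.Ici t) t := by
  refine hasDerivWithinAt_comp_piLp hh fun j => ?_
  by_cases hj : j = Sum.inl i
  · simpa only [State.υhat, State.υhatRate, hj, if_true] using hloop.x_deriv t ht (Sum.inl i)
  · simpa only [State.υhat, State.υhatRate, hj, if_false] using hloop.xhat_deriv t ht i j

theorem continuousOn_hhat (hloop : IsClosedLoop net sys h p T s u unom) (hh : Continuous h)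
    (i : Fin N) : ContinuousOn (fun t => (s t).hhat h i) (horizon T) :=
  (hh.comp_continuousOn (hloop.continuousOn_υhat i)).sub (hloop.ϑ_cont i)

theorem continuousOn_e (hloop : IsClosedLoop net sys h p T s u unom) (hh : Continuous h)
    (i : Fin N) : ContinuousOn (fun t => (s t).e h i) (horizon T) :=
  (hh.comp_continuousOn hloop.x_cont).sub (hloop.continuousOn_hhat hh i)

theorem hasDerivWithinAt_hhat (hloop : IsClosedLoop net sys h p T s u unom)
    (hh : Differentiable ℝ h) {t : ℝ} (ht : t ∈ horizon T) {i : Fin N}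
    (hb : (s t).InBounds h p t i) :
    HasDerivWithinAt (fun τ => (s τ).hhat h i)
      ((s t).constraintLHS net sys h p t i (u t (Sum.inl i))) (Set.Ici t) t := by
  rw [State.constraintLHS_eq]
  exact (hloop.hasDerivWithinAt_h_υhat hh ht i).sub (hloop.ϑ_deriv t ht i hb)

/-- On compact time intervals the reconstruction error is driven by the adaptive law up to a
bounded perturbation. -/
theorem exists_abs_e_deriv_sub_ϑRate_le (hloop : IsClosedLoop net sys h p T s u unom)
    (hsys : sys.IsRegular) (hh : ContDiff ℝ 1 h)
    (hbdd : ∃ D : ℝ, 0 < D ∧ ∀ t ∈ horizon T, ∀ j, ‖sys.g ((s t).x j) (u t j)‖ ≤ D)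
    {K : Set ℝ} (hK : IsCompact K) (hKT : K ⊆ horizon T) (i : Fin N) :
    ∃ C, 0 ≤ C ∧ ∀ t ∈ K, (s t).InBounds h p t i → ∃ w, |w| ≤ C ∧
      HasDerivWithinAt (fun τ => (s τ).e h i) (w + (s t).ϑRate net sys h p t i)
        (Set.Ici t) t := by
  obtain ⟨⟨L, hL⟩, -⟩ := hsys
  obtain ⟨D, -, hD⟩ := hbdd
  have hf := hL.continuous
  have hdiff := hh.differentiable one_ne_zero
  -- The drift is bounded by continuity on the compact set `K`, the input term by the assumed `D`.
  have hv : ∀ j, ∃ C, ∀ t ∈ K, ‖sys.f ((s t).x j) + sys.g ((s t).x j) (u t j)‖ ≤ C := by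
    intro j
    obtain ⟨B, hB⟩ := hK.exists_bound_of_continuousOn
      (hf.comp_continuousOn ((hloop.continuousOn_x_apply j).mono hKT))
    exact ⟨B + D, fun t ht => (norm_add_le _ _).trans (add_le_add (hB t ht) (hD t (hKT ht) j))⟩
  obtain ⟨C₁, hC₁⟩ := exists_abs_fderiv_le hh hK (hloop.x_cont.mono hKT)
    (v := fun t => WithLp.toLp 2 fun j => sys.f ((s t).x j) + sys.g ((s t).x j) (u t j)) hv
  obtain ⟨C₂, hC₂⟩ := exists_abs_fderiv_le hh hK ((hloop.continuousOn_υhat i).mono hKT)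
    (v := fun t => (s t).υhatRate net sys i
      (sys.f ((s t).x (Sum.inl i)) + sys.g ((s t).x (Sum.inl i)) (u t (Sum.inl i)))) (by
      intro j
      by_cases hj : j = Sum.inl i
      · simpa only [State.υhatRate, hj, if_true] using hv (Sum.inl i)
      · simpa only [State.υhatRate, hj, if_false] using hK.exists_bound_of_continuousOn
          ((hloop.continuousOn_xhatRate hf i j).mono hKT))
  -- The absolute values cover empty `K`, where `C₁` and `C₂` may be negative.
  refine ⟨|C₁| + |C₂|, by positivity, fun t ht hb => ?_⟩
  have hd := (hloop.hasDerivWithinAt_h_x hdiff (hKT ht)).sub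
    (hloop.hasDerivWithinAt_hhat hdiff (hKT ht) hb)
  rw [State.constraintLHS_eq, ← sub_add] at hd
  exact ⟨_, (abs_sub _ _).trans
    (add_le_add ((hC₁ t ht).trans (le_abs_self _)) ((hC₂ t ht).trans (le_abs_self _))), hd⟩

/-- The performance bounds `0 < e_i < ρ_i` are maintained. -/
theorem inBounds (hloop : IsClosedLoop net sys h p T s u unom)
    (hsys : sys.IsRegular) (hp : p.IsAdmissible) (hh : ContDiff ℝ 1 h)
    (hbdd : ∃ D : ℝ, 0 < D ∧ ∀ t ∈ horizon T, ∀ j, ‖sys.g ((s t).x j) (u t j)‖ ≤ D)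
    {i : Fin N} (h0 : 0 < (s 0).e h i) (h0ρ : (s 0).e h i < p.ρ₀ i)
    {b : ℝ} (hbT : Set.Icc 0 b ⊆ horizon T) :
    ∀ t ∈ Set.Icc 0 b, (s t).InBounds h p t i := by
  obtain ⟨C, hC, hder⟩ := hloop.exists_abs_e_deriv_sub_ϑRate_le hsys hh hbdd isCompact_Icc hbT i
  have hR : 0 < p.ϱ * (p.ρ₀ i - p.ρinf i) := mul_pos hp.ϱ_pos (sub_pos.2 (hp.ρinf_lt i))
  set R := p.ϱ * (p.ρ₀ i - p.ρinf i) with hRdef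
  -- The tube of margin `δ` must contain the initial error, its walls must lie where `|ε_i| ≥ 1/2`
  -- (hence `4δ ≤ ρinf`), and the push `1/(8δ)` must beat the perturbation `C` plus the decay bound
  -- `R`. The `+ 1` in the witness makes the last inequality strict.
  obtain ⟨δ, hδ, hδ1, hδ2, hδ3, hδ4⟩ : ∃ δ : ℝ, 0 < δ ∧ δ ≤ (s 0).e h i ∧
      δ ≤ p.ρ₀ i - (s 0).e h i ∧ 4 * δ ≤ p.ρinf i ∧ C + R < 1 / (8 * δ) := by
    have hCR : 0 < 1 / (8 * (C + R + 1)) := by positivity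
    have hρ := hp.ρinf_pos i
    refine ⟨min (min ((s 0).e h i) (p.ρ₀ i - (s 0).e h i))
      (min (p.ρinf i / 4) (1 / (8 * (C + R + 1)))), ?_, ?_, ?_, ?_, ?_⟩
    · exact lt_min (lt_min h0 (sub_pos.2 h0ρ)) (lt_min (by positivity) hCR)
    · exact (min_le_left _ _).trans (min_le_left _ _)
    · exact (min_le_left _ _).trans (min_le_right _ _)
    · have := (min_le_right (min ((s 0).e h i) (p.ρ₀ i - (s 0).e h i))
        (min (p.ρinf i / 4) (1 / (8 * (C + R + 1))))).trans (min_le_left _ _)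
      linarith
    · set δ := min (min ((s 0).e h i) (p.ρ₀ i - (s 0).e h i))
        (min (p.ρinf i / 4) (1 / (8 * (C + R + 1))))
      have hδ : 0 < δ := lt_min (lt_min h0 (sub_pos.2 h0ρ)) (lt_min (by positivity) hCR)
      have hle : δ ≤ 1 / (8 * (C + R + 1)) := (min_le_right _ _).trans (min_le_right _ _)
      rw [le_div_iff₀ (by positivity)] at hle
      rw [lt_div_iff₀ (by positivity)]
      nlinarith
  have hec : ContinuousOn (fun t => (s t).e h i) (Set.Icc 0 b) :=
    (hloop.continuousOn_e hh.continuous i).mono hbT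
  have hρc : Continuous (p.ρ i) :=
    continuous_iff_continuousAt.2 fun t => (p.hasDerivAt_ρ i t).continuousAt
  have key := nonneg_of_right_deriv_inward (φ := fun t => (s t).e h i - δ)
    (ψ := fun t => p.ρ i t - (s t).e h i - δ) (hec.sub continuousOn_const)
    ((hρc.continuousOn.sub hec).sub continuousOn_const) (by linarith)
    (by simp only [Params.ρ_zero]; linarith) ?_ ?_
  · intro t ht
    obtain ⟨h1, h2⟩ := key t ht
    exact ⟨by linarith, by linarith⟩
  -- Lower wall `e_i = δ`: the derivative is at least `1/(8δ) - R - C > 0`.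
  · intro t ht h1 h2
    have h1 : (s t).e h i = δ := by linarith
    have hρ := hp.ρinf_lt_ρ i t
    have hb : (s t).InBounds h p t i := ⟨by linarith, by linarith⟩
    obtain ⟨w, hw, hd⟩ := hder t (Set.Ico_subset_Icc_self ht) hb
    refine ⟨_, ?_, hd.sub_const δ⟩
    have hϑ := State.le_ϑRate (net := net) (sys := sys) hp ht.1 hb
      (State.ε_le_neg_half hb.1 (by linarith))
    rw [h1, ← hRdef] at hϑ
    linarith [(abs_le.1 hw).1]
  -- Upper wall `e_i = ρ_i - δ`: the loss `R` now comes from the shrinking of `ρ_i` instead of the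
  -- adaptive law.
  · intro t ht h1 h2
    have h1 : p.ρ i t - (s t).e h i = δ := by linarith
    have hρ := hp.ρinf_lt_ρ i t
    have hb : (s t).InBounds h p t i := ⟨by linarith, by linarith⟩
    obtain ⟨w, hw, hd⟩ := hder t (Set.Ico_subset_Icc_self ht) hb
    refine ⟨_, ?_, ((p.hasDerivAt_ρ i t).hasDerivWithinAt.sub hd).sub_const δ⟩
    have hϑ := State.ϑRate_le (net := net) (sys := sys) hp ht.1 hb
      (State.half_le_ε hb.2 (by linarith))
    rw [h1] at hϑ
    linarith [(abs_le.1 hw).2, (hp.decay_mem_Icc i ht.1).2]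

/-- The reconstructed barrier functions stay nonnegative. -/
theorem hhat_nonneg (hloop : IsClosedLoop net sys h p T s u unom)
    (hp : p.IsAdmissible) (hh : ContDiff ℝ 1 h) {i : Fin N} (h0 : 0 ≤ (s 0).hhat h i) {b : ℝ}
    (hbT : Set.Icc 0 b ⊆ horizon T) (hin : ∀ t ∈ Set.Icc 0 b, (s t).InBounds h p t i) :
    ∀ t ∈ Set.Icc 0 b, 0 ≤ (s t).hhat h i :=
  nonneg_of_right_deriv_ge_neg_classK (hp.α_classK i).2.1 (hp.α_classK i).2.2
    ((hloop.continuousOn_hhat hh.continuous i).mono hbT) h0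
    (fun t ht => hloop.hasDerivWithinAt_hhat (hh.differentiable one_ne_zero) (hbT ht) (hin t ht))
    (fun t ht => (hloop.input_qp t (hbT ht) i (hin t ht)).1)

end IsClosedLoop

end SafeMAS

theorem theorem2 {N V n m : ℕ} (net : SafeMAS.Network N V) (sys : SafeMAS.Dynamics n m)
    (h : SafeMAS.Stacked N V n → ℝ) (p : SafeMAS.Params N V n m)
    (hsys : sys.IsRegular) (hp : p.IsAdmissible)
    (hnet : net.IsConnected)
    (hh : ContDiff ℝ 1 h) (hdh : LocallyLipschitz (fderiv ℝ h))
    (T : EReal) (s : ℝ → SafeMAS.State N V n)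
    (u : ℝ → SafeMAS.Agent N V → SafeMAS.Vec m) (unom : ℝ → Fin N → SafeMAS.Vec m)
    (hloop : SafeMAS.IsClosedLoop net sys h p T s u unom)
    (hbdd : ∃ D : ℝ, 0 < D ∧ ∀ t ∈ SafeMAS.horizon T, ∀ j, ‖sys.g ((s t).x j) (u t j)‖ ≤ D)
    (hsafe : 0 < h (s 0).x) (hinit : SafeMAS.IsInitialized h p (s 0)) :
    ∀ t ∈ SafeMAS.horizon T, (s t).x ∈ SafeMAS.safeSet h := by
  intro t ht
  -- Connectedness of the graph includes that some controllable agent exists, and one is enough.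
  obtain ⟨i⟩ := hnet.1.nonempty
  obtain ⟨h1, h2, h3⟩ := hinit i
  have hbT : Set.Icc 0 t ⊆ SafeMAS.horizon T := fun τ hτ =>
    ⟨hτ.1, (EReal.coe_le_coe_iff.2 hτ.2).trans_lt ht.2⟩
  have hin := hloop.inBounds hsys hp hh hbdd h1 h2 hbT
  have htt : t ∈ Set.Icc 0 t := ⟨ht.1, le_rfl⟩
  have he := (hin t htt).1
  have hhat := hloop.hhat_nonneg hp hh h3 hbT hin t htt
  unfold SafeMAS.State.e at he
  exact (show 0 ≤ h (s t).x by linarith)
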